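/- Let $K\ge 0$ be an integer and let $\gamma_0,\dots,\gamma_K$ be real numbers with $\gamma_0=1$ and $\gamma_K\ne 0$. Let $H_n(x)=(-1)^n e^{x^2}\frac{d^n}{dx^n}e^{-x^2}$ be the standard Hermite polynomials and put $$q_n(x)=\sum_{j=0}^K\gamma_jH_{n-j}(x)\quad (n\ge K),\qquad P(x)=\sum_{j=0}^K\gamma_jx^{K-j}.$$ For finite sets $U,V$ of real numbers, say that $U$ interlaces $V$ if $\min U<\min V$ and strictly between any two consecutive elements of either set there is an element of the other (with the convention $\min\emptyset=+\infty$). (1) If $P$ has only real zeros, then for every $n\ge K$ all the zeros of $q_n$ are real and simple, and the zeros of $q_{n+1}$ interlace the zeros of $q_n$. (2) If $P$ has non-real zeros, then there is a positive integer $n_0\ge K$, depending only on $K$ and the set of non-real zeros of $P$ (and not otherwise on the $\gamma_j$), such that for every $n\ge n_0$ all the zeros of $q_n$ are real and simple, and the zeros of $q_{n+1}$ interlace the zeros of $q_n$. -/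

import Mathlib

open Polynomial

/-- The standard (physicists') Hermite polynomials
`H_n(x) = (-1)^n e^{x²} dⁿ/dxⁿ e^{-x²}`, given by `H_0 = 1`, `H_{n+1} = 2 x H_n - H_n'`. -/
noncomputable def hermiteH : ℕ → ℝ[X]
  | 0 => 1
  | n + 1 => 2 * X * hermiteH n - derivative (hermiteH n)

/-- The defining Rodrigues formula holds: `H_n(x) = (-1)^n e^{x²} dⁿ/dxⁿ e^{-x²}`. -/
theorem hermiteH_rodrigues (n : ℕ) (x : ℝ) :
    (hermiteH n).eval x =
      (-1) ^ n * Real.exp (x ^ 2) * iteratedDeriv n (fun y : ℝ => Real.exp (-y ^ 2)) x := by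
  have key : ∀ n : ℕ, iteratedDeriv n (fun y : ℝ => Real.exp (-y ^ 2)) =
      fun y => (-1) ^ n * (hermiteH n).eval y * Real.exp (-y ^ 2) := by
    intro n
    induction n with
    | zero => ext y; simp [hermiteH]
    | succ n ih =>
      rw [iteratedDeriv_succ, ih]
      ext y
      have h1 : HasDerivAt (fun y : ℝ => Real.exp (-y ^ 2))
          (Real.exp (-y ^ 2) * (-(2 * y))) y := by
        have := ((hasDerivAt_pow 2 y).neg).exp
        simpa using this
      have h2 := (((hermiteH n).hasDerivAt y).const_mul ((-1 : ℝ) ^ n)).mul h1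
      have h3 := h2.deriv
      refine Eq.trans h3 ?_
      simp [hermiteH]
      ring
  rw [key n]
  have h : Real.exp (x ^ 2) * Real.exp (-x ^ 2) = 1 := by
    rw [← Real.exp_add]; simp
  have h' : ((-1 : ℝ) ^ n) * (-1) ^ n = 1 := by
    rw [← mul_pow]; simp
  linear_combination (-(hermiteH n).eval x * (-1) ^ n * (-1) ^ n) * h - (hermiteH n).eval x * h'

/-- The combination `q_n = ∑_{j=0}^K γ_j H_{n-j}`, meaningful for `n ≥ K`. -/
noncomputable def hermiteComb (K : ℕ) (γ : ℕ → ℝ) (n : ℕ) : ℝ[X] :=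
  ∑ j ∈ Finset.range (K + 1), C (γ j) * hermiteH (n - j)

/-- The polynomial `P(x) = ∑_{j=0}^K γ_j x^{K-j}`. -/
noncomputable def symbolP (K : ℕ) (γ : ℕ → ℝ) : ℝ[X] :=
  ∑ j ∈ Finset.range (K + 1), C (γ j) * X ^ (K - j)

/-- The set of non-real complex zeros of a real polynomial. -/
def nonrealZeros (p : ℝ[X]) : Set ℂ :=
  {z | aeval z p = 0 ∧ z.im ≠ 0}

/-- All the complex zeros of `p` are real. -/
def OnlyRealZeros (p : ℝ[X]) : Prop :=
  ∀ z : ℂ, aeval z p = 0 → z.im = 0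

/-- All the complex zeros of `p` are simple. -/
def OnlySimpleZeros (p : ℝ[X]) : Prop :=
  ∀ z : ℂ, aeval z p = 0 → (p.map (algebraMap ℝ ℂ)).rootMultiplicity z = 1

/-- `a < b` are consecutive elements of the finite set `U`. -/
def ConsecutiveIn (U : Finset ℝ) (a b : ℝ) : Prop :=
  a ∈ U ∧ b ∈ U ∧ a < b ∧ ∀ c ∈ U, ¬ (a < c ∧ c < b)

/-- `U` strictly interlaces `V`: `min U < min V`, and (strictly) between any two consecutive
elements of either set there is an element of the other. Here `min ∅ = ⊤`. -/
def StrictlyInterlaces (U V : Finset ℝ) : Prop :=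
  U.min < V.min ∧
  (∀ a b, ConsecutiveIn U a b → ∃ v ∈ V, a < v ∧ v < b) ∧
  (∀ a b, ConsecutiveIn V a b → ∃ u ∈ U, a < u ∧ u < b)

/-- The real zeros of `p` interlace those of `q`. -/
noncomputable def ZerosInterlace (p q : ℝ[X]) : Prop :=
  StrictlyInterlaces p.roots.toFinset q.roots.toFinset

/-! Write T = 2X - d/dx. Since H_n = T^n 1, the combination is q_n = T^(n-K) P(T) 1, and q_(n+1) = T
q_n. At a zero of p, (T - a)p equals -p'. If p has simple real zeros, -p' alternates in sign along
them, so (T - a)p has a zero in every gap and one beyond each end. Thus T - a with a real preserves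
simple real zeros and creates interlacing (`HasSimpleRealRoots.of_eval_mul_derivative_neg`,
`HasSimpleRealRoots.raise_sub`). If P has only real zeros, P(T) is a product of such factors,
applied to H_(n-K).

In general P is a product of real linear factors and a monic Q without real zeros; the linear
factors do no harm, so Q(T) H_(n-K) remains. For large n its top term dominates at the zeros of the
Hermite polynomial of one degree less, by running the three-term recurrence downwards
(`abs_eval_hermiteH_le`), so the same sign criterion applies. The threshold depends only on Q, and
only finitely many Q of degree at most K have their zeros in a given finite set
(`finite_monic_of_zeros_subset`), so a maximum of thresholds is uniform. -/

/-- `p` has degree `n`, positive leading coefficient and `n` distinct real roots. -/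
def HasSimpleRealRoots (n : ℕ) (p : ℝ[X]) : Prop :=
  p.natDegree = n ∧ 0 < p.leadingCoeff ∧ p.roots.toFinset.card = n

/-! ### Polynomials with simple real zeros -/

namespace HasSimpleRealRoots

variable {n : ℕ} {p q : ℝ[X]}

theorem ne_zero (h : HasSimpleRealRoots n p) : p ≠ 0 :=
  leadingCoeff_ne_zero.mp h.2.1.ne'

theorem card_roots (h : HasSimpleRealRoots n p) : p.roots.card = n :=
  le_antisymm ((card_roots' p).trans h.1.le) (h.2.2 ▸ Multiset.toFinset_card_le _)

theorem nodup_roots (h : HasSimpleRealRoots n p) : p.roots.Nodup := by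
  rw [← Multiset.toFinset_card_eq_card_iff_nodup, h.2.2, h.card_roots]

theorem splits (h : HasSimpleRealRoots n p) : p.Splits := by
  rw [splits_iff_card_roots, h.card_roots, h.1]

theorem roots_map_complex (h : HasSimpleRealRoots n p) :
    (p.map (algebraMap ℝ ℂ)).roots = p.roots.map (algebraMap ℝ ℂ) :=
  h.splits.roots_map _

theorem onlyRealZeros (h : HasSimpleRealRoots n p) : OnlyRealZeros p := by
  intro z hz
  have hz' : z ∈ (p.map (algebraMap ℝ ℂ)).roots := by
    rw [mem_roots_map h.ne_zero]
    exact hz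
  rw [h.roots_map_complex, Multiset.mem_map] at hz'
  obtain ⟨x, -, rfl⟩ := hz'
  simp

theorem onlySimpleZeros (h : HasSimpleRealRoots n p) : OnlySimpleZeros p := by
  intro z hz
  have hz' : z ∈ (p.map (algebraMap ℝ ℂ)).roots := by
    rw [mem_roots_map h.ne_zero]
    exact hz
  rw [← count_roots]
  refine Multiset.count_eq_one_of_mem ?_ hz'
  rw [h.roots_map_complex]
  exact h.nodup_roots.map (algebraMap ℝ ℂ).injective

theorem eval_derivative (h : HasSimpleRealRoots n p) {x : ℝ} (hx : x ∈ p.roots) :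
    (derivative p).eval x = p.leadingCoeff * ∏ a ∈ p.roots.toFinset.erase x, (x - a) := by
  have hp := C_leadingCoeff_mul_prod_multiset_X_sub_C (h.card_roots.trans h.1.symm)
  conv_lhs => rw [← hp]
  rw [derivative_C_mul, eval_C_mul, eval_multiset_prod_X_sub_C_derivative hx]
  congr 1
  rw [Finset.prod, Finset.erase_val, Multiset.toFinset_val, h.nodup_roots.dedup]

/-- In the product formula for p' at a zero, each zero to the right contributes one negative factor.
-/
theorem eval_derivative_sign (h : HasSimpleRealRoots n p) (i : Fin n) :
    0 < (-1) ^ (n - 1 - (i : ℕ)) *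
      (derivative p).eval (p.roots.toFinset.orderEmbOfFin h.2.2 i) := by
  set e := p.roots.toFinset.orderEmbOfFin h.2.2 with he
  have hmem : e i ∈ p.roots.toFinset := Finset.orderEmbOfFin_mem _ _ _
  have hV : p.roots.toFinset = Finset.univ.map e.toEmbedding :=
    (Finset.map_orderEmbOfFin_univ _ h.2.2).symm
  rw [h.eval_derivative (Multiset.mem_toFinset.mp hmem), mul_left_comm]
  refine mul_pos h.2.1 ?_
  have h1 : p.roots.toFinset.erase (e i) = (Finset.univ.erase i).map e.toEmbedding := by
    rw [hV, Finset.map_erase]; rfl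
  rw [h1, Finset.prod_map, ← Finset.prod_filter_mul_prod_filter_not _ (fun j => i < j)]
  have h2 : (Finset.univ.erase i).filter (fun j => i < j) = Finset.Ioi i := by
    ext j
    simp only [Finset.mem_filter, Finset.mem_erase, Finset.mem_univ, Finset.mem_Ioi]
    exact ⟨fun h => h.2, fun h => ⟨⟨h.ne', trivial⟩, h⟩⟩
  rw [h2, ← mul_assoc, ← Fin.card_Ioi, ← Finset.prod_const, ← Finset.prod_mul_distrib]
  refine mul_pos (Finset.prod_pos fun j hj => ?_) (Finset.prod_pos fun j hj => ?_)
  · have := e.strictMono (Finset.mem_Ioi.mp hj)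
    simp only [RelEmbedding.coe_toEmbedding]
    linarith
  · simp only [Finset.mem_filter, Finset.mem_erase, Finset.mem_univ, not_lt] at hj
    have := e.strictMono (lt_of_le_of_ne hj.2 hj.1.1)
    simp only [RelEmbedding.coe_toEmbedding]
    linarith

end HasSimpleRealRoots

/-! ### Sign changes and interlacing -/

/-- A polynomial of positive degree with positive leading coefficient is positive far right. -/
theorem Polynomial.exists_gt_eval_pos {q : ℝ[X]} (hd : 0 < q.natDegree)
    (hl : 0 < q.leadingCoeff) (B : ℝ) : ∃ R, B < R ∧ 0 < q.eval R := by
  have ht := q.tendsto_atTop_of_leadingCoeff_nonneg (natDegree_pos_iff_degree_pos.mp hd) hl.le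
  obtain ⟨R, h1, h2⟩ := ((Filter.eventually_gt_atTop B).and (ht.eventually_gt_atTop 0)).exists
  exact ⟨R, h1, h2⟩

theorem Polynomial.exists_lt_eval_sign {q : ℝ[X]} (hd : 0 < q.natDegree)
    (hl : 0 < q.leadingCoeff) (B : ℝ) :
    ∃ L, L < B ∧ 0 < (-1) ^ q.natDegree * q.eval L := by
  set r : ℝ[X] := C ((-1) ^ q.natDegree) * q.comp (-X) with hr
  have hc : ((-1 : ℝ) ^ q.natDegree) ≠ 0 := pow_ne_zero _ (by norm_num)
  have hrd : r.natDegree = q.natDegree := by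
    rw [hr, natDegree_C_mul hc, natDegree_comp, natDegree_neg, natDegree_X, mul_one]
  have hrl : r.leadingCoeff = q.leadingCoeff := by
    rw [hr, leadingCoeff_mul, leadingCoeff_C, leadingCoeff_comp (by simp), leadingCoeff_neg,
      leadingCoeff_X, mul_left_comm, ← mul_pow]
    simp
  obtain ⟨R, h1, h2⟩ := exists_gt_eval_pos (hrd ▸ hd) (hrl ▸ hl) (-B)
  refine ⟨-R, by linarith, ?_⟩
  simpa [hr] using h2

/-- A real function changing sign on `[a, b]` vanishes in between. -/
theorem Polynomial.exists_isRoot_of_mul_neg (q : ℝ[X]) {a b : ℝ} (hab : a < b)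
    (h : q.eval a * q.eval b < 0) : ∃ y, a < y ∧ y < b ∧ q.eval y = 0 := by
  have hc : ContinuousOn (fun x => q.eval x) (Set.Icc a b) := q.continuous.continuousOn
  rcases mul_neg_iff.mp h with ⟨h1, h2⟩ | ⟨h1, h2⟩
  · obtain ⟨y, hy, hy0⟩ := intermediate_value_Ioo' hab.le hc ⟨h2, h1⟩
    exact ⟨y, hy.1, hy.2, hy0⟩
  · obtain ⟨y, hy, hy0⟩ := intermediate_value_Ioo hab.le hc ⟨h1, h2⟩
    exact ⟨y, hy.1, hy.2, hy0⟩

/-- Alternating families interlace. -/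
theorem strictlyInterlaces_of_alternating {n : ℕ} {U V : Finset ℝ} {x y : ℕ → ℝ}
    (hU : ∀ u, u ∈ U ↔ ∃ i ≤ n, y i = u) (hV : ∀ v, v ∈ V ↔ ∃ i < n, x i = v)
    (hyx : ∀ i < n, y i < x i) (hxy : ∀ i < n, x i < y (i + 1)) :
    StrictlyInterlaces U V := by
  have hy : ∀ j, j ≤ n → ∀ i ≤ j, y i ≤ y j := by
    intro j
    induction j with
    | zero => intro _ i hi; rw [Nat.le_zero.mp hi]
    | succ j ih =>
      intro hj i hi
      rcases hi.eq_or_lt with rfl | hi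
      · exact le_rfl
      · exact (ih (by omega) i (by omega)).trans ((hyx j hj).trans (hxy j hj)).le
  refine ⟨?_, ?_, ?_⟩
  · have h0 : y 0 ∈ U := (hU _).mpr ⟨0, n.zero_le, rfl⟩
    refine (Finset.min_le h0).trans_lt ?_
    rcases V.eq_empty_or_nonempty with rfl | hne
    · simp [WithTop.coe_lt_top]
    · rw [← Finset.coe_min' hne, WithTop.coe_lt_coe]
      obtain ⟨i, hi, h⟩ := (hV _).mp (V.min'_mem hne)
      rw [← h]
      exact (hy i hi.le 0 i.zero_le).trans_lt (hyx i hi)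
  · rintro a b ⟨ha, hb, hab, -⟩
    obtain ⟨i, hi, rfl⟩ := (hU _).mp ha
    obtain ⟨j, hj, rfl⟩ := (hU _).mp hb
    have hij : i < j := by
      by_contra! hc
      exact absurd (hy i hi j hc) (not_le.mpr hab)
    exact ⟨x i, (hV _).mpr ⟨i, by omega, rfl⟩, hyx i (by omega),
      (hxy i (by omega)).trans_le (hy j hj _ hij)⟩
  · rintro a b ⟨ha, hb, hab, -⟩
    obtain ⟨i, hi, rfl⟩ := (hV _).mp ha
    obtain ⟨j, hj, rfl⟩ := (hV _).mp hb
    have hij : i < j := by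
      by_contra! hc
      rcases hc.eq_or_lt with rfl | hc
      · exact lt_irrefl _ hab
      · exact absurd (((hxy j hj).trans_le (hy i hi.le _ hc)).trans (hyx i hi)) hab.asymm
    exact ⟨y (i + 1), (hU _).mpr ⟨i + 1, hi, rfl⟩, hxy i hi,
      (hy j hj.le _ hij).trans_lt (hyx j hj)⟩

/-- If `q` has degree one more than `p` and sign opposite to `p'` at all the zeros of `p`, then `q`
inherits real simple zeros from `p`, and these interlace the zeros of `p`. -/
theorem HasSimpleRealRoots.of_eval_mul_derivative_neg {n : ℕ} {p q : ℝ[X]}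
    (h : HasSimpleRealRoots n p) (hd : q.natDegree = n + 1) (hl : 0 < q.leadingCoeff)
    (hs : ∀ x, p.eval x = 0 → q.eval x * (derivative p).eval x < 0) :
    HasSimpleRealRoots (n + 1) q ∧ ZerosInterlace q p := by
  set e := p.roots.toFinset.orderEmbOfFin h.2.2 with he
  have hroot : ∀ i, p.eval (e i) = 0 := fun i =>
    (mem_roots'.mp (Multiset.mem_toFinset.mp (Finset.orderEmbOfFin_mem _ h.2.2 i))).2
  have hsign : ∀ i : Fin n, 0 < (-1) ^ (n - (i : ℕ)) * q.eval (e i) := by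
    intro i
    have h1 := h.eval_derivative_sign i
    have h2 := hs _ (hroot i)
    rw [show n - (i : ℕ) = (n - 1 - i) + 1 by omega, pow_succ]
    rcases neg_one_pow_eq_or ℝ (n - 1 - (i : ℕ)) with h3 | h3 <;> rw [h3] at h1 ⊢ <;>
      nlinarith
  obtain ⟨B, hB⟩ : ∃ B, ∀ i, |e i| ≤ B := by
    obtain ⟨B, hB⟩ := (Set.finite_range fun i => |e i|).bddAbove
    exact ⟨B, fun i => hB ⟨i, rfl⟩⟩
  obtain ⟨R, hR, hqR⟩ := exists_gt_eval_pos (by omega) hl (max B 0)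
  obtain ⟨L, hL, hqL⟩ := exists_lt_eval_sign (by omega) hl (-max B 0)
  -- Test points: the zeros of p flanked by a far left L and a far right R. The signs of q alternate
  -- along them, giving n + 1 zeros, which exhaust its degree.
  let z : ℕ → ℝ := fun i => if i = 0 then L else if hi : i - 1 < n then e ⟨i - 1, hi⟩ else R
  have hz0 : z 0 = L := rfl
  have hzx : ∀ i (hi : i < n), z (i + 1) = e ⟨i, hi⟩ := fun i hi => by simp [z, hi]
  have hzR : z (n + 1) = R := by simp [z]
  have hLR : L < R := by linarith [le_max_right B 0]
  have hzlt : ∀ i ≤ n, z i < z (i + 1) := by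
    rintro (_ | i) hi
    · rcases n.eq_zero_or_pos with rfl | hn
      · rw [hz0, hzR]; exact hLR
      · rw [hz0, hzx 0 hn]
        have := (abs_le.mp (hB ⟨0, hn⟩)).1
        linarith [le_max_left B 0]
    · rw [hzx i hi]
      rcases Nat.lt_or_ge (i + 1) n with hi' | hi'
      · rw [hzx _ hi']
        exact e.strictMono (Fin.mk_lt_mk.mpr i.lt_succ_self)
      · obtain rfl : n = i + 1 := by omega
        rw [hzR]
        have := (abs_le.mp (hB ⟨i, hi⟩)).2
        linarith [le_max_left B 0]
  have hzs : ∀ i ≤ n + 1, 0 < (-1) ^ (n + 1 - i) * q.eval (z i) := by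
    rintro (_ | i) hi
    · rw [hz0, Nat.sub_zero, ← hd]; exact hqL
    · rcases Nat.lt_or_ge i n with hi' | hi'
      · rw [hzx i hi', Nat.add_sub_add_right]
        exact hsign ⟨i, hi'⟩
      · obtain rfl : i = n := by omega
        rw [hzR]; simpa using hqR
  have hy : ∀ i, ∃ y, i ≤ n → z i < y ∧ y < z (i + 1) ∧ q.eval y = 0 := by
    intro i
    by_cases hi : i ≤ n
    · have h1 := hzs i (by omega)
      have h2 := hzs (i + 1) (by omega)
      rw [show n + 1 - i = (n + 1 - (i + 1)) + 1 by omega, pow_succ] at h1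
      obtain ⟨y, hy⟩ := q.exists_isRoot_of_mul_neg (hzlt i hi) (by
        rcases neg_one_pow_eq_or ℝ (n + 1 - (i + 1)) with h3 | h3 <;> rw [h3] at h1 h2 <;>
          nlinarith)
      exact ⟨y, fun _ => hy⟩
    · exact ⟨0, fun h => absurd h hi⟩
  choose y hy using hy
  have hmono : StrictMono fun i : Fin (n + 1) => y i := by
    rw [Fin.strictMono_iff_lt_succ]
    intro i
    simpa using (hy i (by omega)).2.1.trans (hy (i + 1) (by omega)).1
  have hq0 : q ≠ 0 := leadingCoeff_ne_zero.mp hl.ne'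
  have hsub : Finset.univ.image (fun i : Fin (n + 1) => y i) ⊆ q.roots.toFinset := by
    intro u hu
    obtain ⟨i, -, rfl⟩ := Finset.mem_image.mp hu
    exact Multiset.mem_toFinset.mpr ((mem_roots hq0).mpr (hy i (by omega)).2.2)
  have hcard : (Finset.univ.image (fun i : Fin (n + 1) => y i)).card = n + 1 := by
    rw [Finset.card_image_of_injective _ hmono.injective, Finset.card_fin]
  have hle : q.roots.toFinset.card ≤ n + 1 :=
    (Multiset.toFinset_card_le _).trans (hd ▸ card_roots' q)
  have heq := Finset.eq_of_subset_of_card_le hsub (hle.trans hcard.ge)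
  refine ⟨⟨hd, hl, heq ▸ hcard⟩, ?_⟩
  refine strictlyInterlaces_of_alternating (n := n) (x := fun i => z (i + 1)) (y := y)
    (fun u => ?_) (fun v => ?_) (fun i hi => (hy i hi.le).2.1) (fun i hi => (hy (i + 1) hi).1)
  · rw [← heq, Finset.mem_image]
    exact ⟨fun ⟨i, _, hi⟩ => ⟨i, by omega, hi⟩,
      fun ⟨i, hi, hi'⟩ => ⟨⟨i, by omega⟩, Finset.mem_univ _, hi'⟩⟩
  · rw [← Finset.mem_coe, ← Finset.range_orderEmbOfFin _ h.2.2, Set.mem_range]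
    exact ⟨fun ⟨i, hi⟩ => ⟨i, i.2, (hzx i i.2).trans hi⟩,
      fun ⟨i, hi, hi'⟩ => ⟨⟨i, hi⟩, (hzx i hi).symm.trans hi'⟩⟩

/-! ### The raising operator -/

/-- The raising operator `p ↦ 2 X p - p'` of the Hermite polynomials. -/
noncomputable def hermiteRaise : Module.End ℝ ℝ[X] :=
  LinearMap.mulLeft ℝ (2 * X) - derivative

theorem hermiteRaise_apply (p : ℝ[X]) : hermiteRaise p = 2 * X * p - derivative p := rfl

theorem hermiteH_eq_pow_apply (n : ℕ) : hermiteH n = (hermiteRaise ^ n) 1 := by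
  induction n with
  | zero => rfl
  | succ n ih => rw [pow_succ', Module.End.mul_apply, ← ih]; rfl

theorem aeval_hermiteRaise_X_pow_mul (n : ℕ) (Q : ℝ[X]) :
    aeval hermiteRaise (X ^ n * Q) 1 =
      ∑ i ∈ Finset.range (Q.natDegree + 1), C (Q.coeff i) * hermiteH (n + i) := by
  conv_lhs => rw [Q.as_sum_range_C_mul_X_pow, Finset.mul_sum]
  rw [map_sum, LinearMap.sum_apply]
  refine Finset.sum_congr rfl fun i _ => ?_
  rw [mul_left_comm, ← pow_add, map_mul, aeval_C, map_pow, aeval_X, Module.End.mul_apply,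
    ← hermiteH_eq_pow_apply, Module.algebraMap_end_apply, smul_eq_C_mul]

theorem hermiteComb_eq_aeval {K n : ℕ} (γ : ℕ → ℝ) (h : K ≤ n) :
    hermiteComb K γ n = aeval hermiteRaise (X ^ (n - K) * symbolP K γ) 1 := by
  rw [hermiteComb, symbolP, Finset.mul_sum, map_sum, LinearMap.sum_apply]
  refine Finset.sum_congr rfl fun i hi => ?_
  rw [Finset.mem_range] at hi
  rw [mul_left_comm, ← pow_add, map_mul, aeval_C, map_pow, aeval_X, Module.End.mul_apply,
    ← hermiteH_eq_pow_apply, Module.algebraMap_end_apply, smul_eq_C_mul,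
    show n - K + (K - i) = n - i by omega]

theorem natDegree_hermiteRaise_sub {n : ℕ} {p : ℝ[X]} (hd : p.natDegree = n)
    (hl : 0 < p.leadingCoeff) (a : ℝ) :
    ((2 * X - C a) * p - derivative p).natDegree = n + 1 ∧
      0 < ((2 * X - C a) * p - derivative p).leadingCoeff := by
  have hc : ((2 * X - C a) * p - derivative p).coeff (n + 1) = 2 * p.leadingCoeff := by
    have h1 : p.coeff (n + 1) = 0 := coeff_eq_zero_of_natDegree_lt (by omega)
    have h2 : (derivative p).coeff (n + 1) = 0 :=
      coeff_eq_zero_of_natDegree_lt ((natDegree_derivative_le p).trans_lt (by omega))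
    rw [sub_mul, mul_assoc, coeff_sub, coeff_sub, h2, coeff_C_mul, h1, ← C_ofNat, coeff_C_mul,
      coeff_X_mul, ← hd, leadingCoeff]
    simp
  have hle : ((2 * X - C a) * p - derivative p).natDegree ≤ n + 1 := by
    have h1 : (2 * X - C a).natDegree ≤ 1 := by
      refine (natDegree_sub_le_of_le (m := 1) (n := 0) ?_ (natDegree_C a).le)
      rw [← C_ofNat]
      exact (natDegree_C_mul_le _ _).trans natDegree_X_le
    have h2 : ((2 * X - C a) * p).natDegree ≤ n + 1 :=
      (natDegree_mul_le_of_le h1 hd.le).trans (add_comm 1 n).le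
    have h3 : (derivative p).natDegree ≤ n + 1 := (natDegree_derivative_le p).trans (by omega)
    exact (natDegree_sub_le_of_le h2 h3).trans (max_self _).le
  have hdeg := natDegree_eq_of_le_of_coeff_ne_zero hle (by rw [hc]; positivity)
  refine ⟨hdeg, ?_⟩
  rw [leadingCoeff, hdeg, hc]
  positivity

theorem hermiteH_natDegree (n : ℕ) :
    (hermiteH n).natDegree = n ∧ 0 < (hermiteH n).leadingCoeff := by
  induction n with
  | zero => simp [hermiteH]
  | succ n ih => simpa [hermiteH] using natDegree_hermiteRaise_sub ih.1 ih.2 0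

namespace HasSimpleRealRoots

variable {n : ℕ} {p : ℝ[X]}

theorem eval_derivative_ne_zero (h : HasSimpleRealRoots n p) {x : ℝ} (hx : p.eval x = 0) :
    (derivative p).eval x ≠ 0 := by
  rw [h.eval_derivative ((mem_roots h.ne_zero).mpr hx)]
  refine mul_ne_zero h.2.1.ne' (Finset.prod_ne_zero_iff.mpr fun a ha => ?_)
  exact sub_ne_zero.mpr (Finset.ne_of_mem_erase ha).symm

theorem raise_sub (h : HasSimpleRealRoots n p) (a : ℝ) :
    HasSimpleRealRoots (n + 1) ((2 * X - C a) * p - derivative p) ∧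
      ZerosInterlace ((2 * X - C a) * p - derivative p) p := by
  have hd := natDegree_hermiteRaise_sub h.1 h.2.1 a
  refine h.of_eval_mul_derivative_neg hd.1 hd.2 fun x hx => ?_
  have := mul_self_pos.mpr (h.eval_derivative_ne_zero hx)
  simpa [hx] using this

theorem aeval_X_sub_C (h : HasSimpleRealRoots n p) (a : ℝ) :
    HasSimpleRealRoots (n + 1) (aeval hermiteRaise (X - C a) p) := by
  convert (h.raise_sub a).1 using 1
  simp [hermiteRaise_apply, smul_eq_C_mul]
  ring

theorem aeval_prod_X_sub_C (h : HasSimpleRealRoots n p) (s : Multiset ℝ) :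
    HasSimpleRealRoots (n + s.card) (aeval hermiteRaise (s.map fun a => X - C a).prod p) := by
  induction s using Multiset.induction with
  | empty => simpa using h
  | cons a s ih =>
    rw [Multiset.map_cons, Multiset.prod_cons, map_mul, Module.End.mul_apply, Multiset.card_cons]
    exact ih.aeval_X_sub_C a

theorem raise (h : HasSimpleRealRoots n p) : ZerosInterlace (hermiteRaise p) p := by
  simpa [hermiteRaise_apply] using (h.raise_sub 0).2

end HasSimpleRealRoots

/-! ### Zeros and growth of Hermite polynomials -/

theorem hasSimpleRealRoots_one : HasSimpleRealRoots 0 1 := by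
  simp [HasSimpleRealRoots]

theorem hasSimpleRealRoots_hermiteH (n : ℕ) : HasSimpleRealRoots n (hermiteH n) := by
  induction n with
  | zero => exact hasSimpleRealRoots_one
  | succ n ih => simpa [hermiteH] using (ih.raise_sub 0).1

theorem derivative_hermiteH_succ (n : ℕ) :
    derivative (hermiteH (n + 1)) = 2 * (n + 1 : ℝ[X]) * hermiteH n := by
  induction n with
  | zero => simp [hermiteH]
  | succ n ih =>
    have h1 : hermiteH (n + 2) = 2 * X * hermiteH (n + 1) - derivative (hermiteH (n + 1)) := rfl
    have h2 : hermiteH (n + 1) = 2 * X * hermiteH n - derivative (hermiteH n) := rfl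
    rw [h1, ih]
    simp only [derivative_sub, derivative_mul, derivative_X, derivative_add, derivative_one,
      derivative_natCast, derivative_ofNat, ih]
    rw [h2]
    push_cast
    ring

theorem eval_hermiteH_add_two (n : ℕ) (x : ℝ) :
    (hermiteH (n + 2)).eval x =
      2 * x * (hermiteH (n + 1)).eval x - 2 * (n + 1) * (hermiteH n).eval x := by
  have h1 : hermiteH (n + 2) = 2 * X * hermiteH (n + 1) - derivative (hermiteH (n + 1)) := rfl
  rw [h1, derivative_hermiteH_succ]
  simp

/-- If x² ≥ 2n, the three-term recurrence forces |H_(k+1)| ≥ |x| |H_k| > 0 for all k < n, so H_n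
cannot vanish at x. -/
theorem sq_lt_of_eval_hermiteH_eq_zero {n : ℕ} {x : ℝ} (h : (hermiteH n).eval x = 0) :
    x ^ 2 < 2 * n ∨ n = 0 := by
  by_contra! hc
  obtain ⟨hx, hn⟩ := hc
  have hn' : (1 : ℝ) ≤ n := by exact_mod_cast Nat.one_le_iff_ne_zero.mpr hn
  have hx0 : 0 < |x| := abs_pos.mpr fun h0 => by rw [h0] at hx; norm_num at hx; linarith
  have key : ∀ k, k + 1 ≤ n → 0 < |(hermiteH k).eval x| ∧
      |x| * |(hermiteH k).eval x| ≤ |(hermiteH (k + 1)).eval x| := by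
    intro k
    induction k with
    | zero =>
      intro _
      simp [hermiteH, abs_mul]
      linarith
    | succ k ih =>
      intro hk
      obtain ⟨h1, h2⟩ := ih (by omega)
      refine ⟨(mul_pos hx0 h1).trans_le h2, ?_⟩
      rw [eval_hermiteH_add_two]
      have h3 := abs_sub_abs_le_abs_sub (2 * x * (hermiteH (k + 1)).eval x)
        (2 * (k + 1) * (hermiteH k).eval x)
      rw [abs_mul, abs_mul, abs_mul (2 * ((k : ℝ) + 1)), abs_of_pos (by positivity :
        (0 : ℝ) < 2 * (k + 1)), abs_two] at h3
      have h4 : 2 * ((k : ℝ) + 1) ≤ |x| * |x| := by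
        rw [abs_mul_abs_self, ← sq]
        have : (k : ℝ) + 1 ≤ n := by exact_mod_cast (by omega : k + 1 ≤ n)
        linarith
      have h5 := mul_le_mul_of_nonneg_right h4 h1.le
      have h6 := mul_le_mul_of_nonneg_left h2 hx0.le
      nlinarith
  obtain ⟨m, rfl⟩ := Nat.exists_eq_succ_of_ne_zero hn
  obtain ⟨h1, h2⟩ := key m le_rfl
  have h3 := (mul_pos hx0 h1).trans_le h2
  rw [Nat.succ_eq_add_one] at h
  rw [h] at h3
  simp at h3

/-- At a zero of `H_{m+1}`, the lower Hermite polynomials are small compared with `H_{m+2}`. -/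
theorem abs_eval_hermiteH_le {m k : ℕ} {x : ℝ} (h : (hermiteH (m + 1)).eval x = 0)
    (hk : 2 * |x| + 1 ≤ 2 * k) (j : ℕ) (hj : j ≤ m + 1) (hkj : k + j ≤ m + 1) :
    |(hermiteH (m + 1 - j)).eval x| ≤ |(hermiteH (m + 2)).eval x| / (2 * (m + 1)) := by
  induction j using Nat.strong_induction_on with
  | _ j ih =>
    match j, ih, hj, hkj with
    | 0, _, _, _ => rw [Nat.sub_zero, h, abs_zero]; positivity
    | 1, _, _, _ =>
      rw [Nat.add_sub_cancel, eval_hermiteH_add_two, h, mul_zero, zero_sub, abs_neg, abs_mul,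
        abs_of_pos (by positivity : (0 : ℝ) < 2 * (m + 1)), mul_div_cancel_left₀ _ (by positivity)]
    | j + 2, ih, hj, hkj =>
      set B := |(hermiteH (m + 2)).eval x| / (2 * ((m : ℝ) + 1)) with hB
      have hB0 : 0 ≤ B := by positivity
      obtain ⟨i, rfl⟩ : ∃ i, m = j + 1 + i := ⟨m - (j + 1), by omega⟩
      have h1 := ih (j + 1) (by omega) (by omega) (by omega)
      have h2 := ih j (by omega) (by omega) (by omega)
      rw [show j + 1 + i + 1 - (j + 1) = i + 1 by omega] at h1
      rw [show j + 1 + i + 1 - j = i + 2 by omega, eval_hermiteH_add_two] at h2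
      rw [show j + 1 + i + 1 - (j + 2) = i by omega]
      -- The recurrence solved for its lowest term: 2(i+1)|H_i| ≤ 2|x||H_(i+1)| + |H_(i+2)| ≤
      -- (2|x|+1)B, and 2|x|+1 ≤ 2k ≤ 2(i+1).
      have h3 := abs_sub_abs_le_abs_sub (2 * ((i : ℝ) + 1) * (hermiteH i).eval x)
        (2 * x * (hermiteH (i + 1)).eval x)
      rw [abs_sub_comm, abs_mul, abs_mul (2 * x), abs_mul 2 x, abs_of_pos (by positivity :
        (0 : ℝ) < 2 * (i + 1)), abs_two] at h3
      have h4 : (k : ℝ) ≤ i := by exact_mod_cast (by omega : k ≤ i)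
      have h5 := mul_le_mul_of_nonneg_left h1 (by positivity : 0 ≤ 2 * |x|)
      have h6 : 2 * ((i : ℝ) + 1) * |(hermiteH i).eval x| ≤ 2 * ((i : ℝ) + 1) * B := by
        have := mul_le_mul_of_nonneg_right (hk.trans (by linarith : 2 * (k : ℝ) ≤ 2 * (i + 1))) hB0
        linarith
      exact le_of_mul_le_mul_left h6 (by positivity)

/-! ### Dominance of the top term for large n -/

theorem aeval_hermiteRaise_eq_lower_add {Q : ℝ[X]} (hQ : Q.Monic) (n : ℕ) :
    aeval hermiteRaise (X ^ n * Q) 1 =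
      ∑ i ∈ Finset.range Q.natDegree, C (Q.coeff i) * hermiteH (n + i) +
        hermiteH (n + Q.natDegree) := by
  rw [aeval_hermiteRaise_X_pow_mul, Finset.sum_range_succ, coeff_natDegree, hQ.leadingCoeff, C_1,
    one_mul]

theorem natDegree_aeval_hermiteRaise {Q : ℝ[X]} (hQ : Q.Monic) (n : ℕ) :
    (aeval hermiteRaise (X ^ n * Q) 1).natDegree = n + Q.natDegree ∧
      0 < (aeval hermiteRaise (X ^ n * Q) 1).leadingCoeff := by
  obtain ⟨h1, h2⟩ := hermiteH_natDegree (n + Q.natDegree)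
  have hlow : ∑ i ∈ Finset.range Q.natDegree, C (Q.coeff i) * hermiteH (n + i) ∈
      degreeLT ℝ (n + Q.natDegree) := by
    refine Submodule.sum_mem _ fun i hi => ?_
    rw [← smul_eq_C_mul]
    refine Submodule.smul_mem _ _ (mem_degreeLT.mpr ?_)
    refine degree_le_natDegree.trans_lt ?_
    rw [(hermiteH_natDegree _).1, Nat.cast_lt]
    have := Finset.mem_range.mp hi
    omega
  have hdeg : degree (∑ i ∈ Finset.range Q.natDegree, C (Q.coeff i) * hermiteH (n + i)) <
      degree (hermiteH (n + Q.natDegree)) := by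
    rw [degree_eq_natDegree (leadingCoeff_ne_zero.mp h2.ne'), h1]
    exact mem_degreeLT.mp hlow
  rw [aeval_hermiteRaise_eq_lower_add hQ]
  exact ⟨(natDegree_add_eq_right_of_degree_lt hdeg).trans h1,
    by rwa [leadingCoeff_add_of_degree_lt hdeg]⟩

/-- For fixed monic `Q` with coefficients `c i`, the combinations `∑ c i H_{n+i}` have real simple
zeros for all large `n`. -/
theorem exists_forall_hasSimpleRealRoots_aeval {Q : ℝ[X]} (hQ : Q.Monic) :
    ∃ N : ℕ, ∀ n, N ≤ n →
      HasSimpleRealRoots (n + Q.natDegree) (aeval hermiteRaise (X ^ n * Q) 1) := by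
  set d := Q.natDegree with hd
  set S := ∑ i ∈ Finset.range d, |Q.coeff i| with hS
  -- d ≤ n gives x² < 4n at the zeros of H_(m+1); with n ≥ 5 this yields 2|x|+1 ≤ 2n. The ceiling
  -- gives S < 2(m+1).
  refine ⟨d + 5 + ⌈S⌉₊, fun n hn => ?_⟩
  obtain ⟨m, hm⟩ : ∃ m, n + d = m + 2 := ⟨n + d - 2, by omega⟩
  have hdeg := natDegree_aeval_hermiteRaise hQ n
  rw [← hd, hm] at hdeg
  rw [hm]
  refine ((hasSimpleRealRoots_hermiteH (m + 1)).of_eval_mul_derivative_neg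
    hdeg.1 hdeg.2 fun x hx => ?_).1
  have hHD : (derivative (hermiteH (m + 1))).eval x = -(hermiteH (m + 2)).eval x := by
    have : hermiteH (m + 2) = 2 * X * hermiteH (m + 1) - derivative (hermiteH (m + 1)) := rfl
    rw [this]
    simp [hx]
  have hne := (hasSimpleRealRoots_hermiteH (m + 1)).eval_derivative_ne_zero hx
  have hxs : 2 * |x| + 1 ≤ 2 * (n : ℝ) := by
    have h1 := (sq_lt_of_eval_hermiteH_eq_zero hx).resolve_right (Nat.succ_ne_zero m)
    have h2 : ((m + 1 : ℕ) : ℝ) ≤ 2 * n := by exact_mod_cast (by omega : m + 1 ≤ 2 * n)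
    have h3 : (5 : ℝ) ≤ n := by exact_mod_cast (by omega : 5 ≤ n)
    rw [← sq_abs] at h1
    by_contra! hc
    nlinarith [abs_nonneg x]
  have hSlt : S < 2 * ((m : ℝ) + 1) := by
    have h1 : (⌈S⌉₊ : ℝ) ≤ m := by exact_mod_cast (by omega : ⌈S⌉₊ ≤ m)
    have := Nat.le_ceil S
    have : (0 : ℝ) ≤ m := m.cast_nonneg
    linarith
  set E := (∑ i ∈ Finset.range d, C (Q.coeff i) * hermiteH (n + i)).eval x with hE
  set h := (hermiteH (m + 2)).eval x with hh
  have hE_le : |E| ≤ S * (|h| / (2 * (m + 1))) := by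
    rw [hE, eval_finsetSum, hS, Finset.sum_mul]
    refine (Finset.abs_sum_le_sum_abs _ _).trans (Finset.sum_le_sum fun i hi => ?_)
    have hi' := Finset.mem_range.mp hi
    rw [eval_C_mul, abs_mul]
    have := abs_eval_hermiteH_le hx hxs (m + 1 - (n + i)) (by omega) (by omega)
    rw [show m + 1 - (m + 1 - (n + i)) = n + i by omega] at this
    exact mul_le_mul_of_nonneg_left this (abs_nonneg _)
  have hpos : 0 < |h| := abs_pos.mpr fun h0 => hne (by rw [hHD, h0, neg_zero])
  have hlt : |E| < |h| := by
    refine hE_le.trans_lt ?_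
    rw [mul_div_assoc', div_lt_iff₀ (by positivity), mul_comm]
    exact mul_lt_mul_of_pos_left hSlt hpos
  rw [aeval_hermiteRaise_eq_lower_add hQ, eval_add, ← hd, hm, hHD]
  have hEh : -(E * h) < h * h := by
    calc -(E * h) ≤ |E * h| := neg_le_abs _
      _ = |E| * |h| := abs_mul _ _
      _ < |h| * |h| := mul_lt_mul_of_pos_right hlt hpos
      _ = h * h := abs_mul_abs_self h
  rw [← hE, ← hh]
  linarith

/-! ### Factoring the symbol; finiteness of the cofactors -/

theorem symbolP_natDegree_monic {K : ℕ} {γ : ℕ → ℝ} (h0 : γ 0 = 1) :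
    (symbolP K γ).natDegree = K ∧ (symbolP K γ).Monic := by
  have hle : (symbolP K γ).natDegree ≤ K :=
    natDegree_sum_le_of_forall_le _ _ fun i _ => (natDegree_C_mul_X_pow_le _ _).trans (by omega)
  have hc : (symbolP K γ).coeff K = 1 := by
    rw [symbolP, finsetSum_coeff, Finset.sum_eq_single 0]
    · simp [h0]
    · intro i hi hi0
      rw [coeff_C_mul_X_pow, if_neg]
      have := Finset.mem_range.mp hi
      omega
    · simp
  have hd := natDegree_eq_of_le_of_coeff_ne_zero hle (by rw [hc]; exact one_ne_zero)
  exact ⟨hd, by rw [Monic, leadingCoeff, hd, hc]⟩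

/-- The monic cofactor of the real zeros of a monic polynomial. -/
theorem Polynomial.Monic.exists_nonreal_cofactor {P : ℝ[X]} (hP : P.Monic) :
    ∃ Q : ℝ[X], Q.Monic ∧ (P.roots.map fun a => X - C a).prod * Q = P ∧
      P.roots.card + Q.natDegree = P.natDegree ∧ ∀ z : ℂ, aeval z Q = 0 → z ∈ nonrealZeros P := by
  obtain ⟨Q, h1, h2, h3⟩ := P.exists_prod_multiset_X_sub_C_mul
  have hQ : Q.Monic := (monic_multiset_prod_of_monic _ _ fun a _ => monic_X_sub_C a).of_mul_monic_left
    (h1.symm ▸ hP)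
  refine ⟨Q, hQ, h1, h2, fun z hz => ⟨?_, fun him => ?_⟩⟩
  · rw [← h1, map_mul, hz, mul_zero]
  · have hzr : z = algebraMap ℝ ℂ z.re := Complex.ext (by simp) (by simp [him])
    rw [hzr, aeval_algebraMap_apply, coe_aeval_eq_eval, map_eq_zero] at hz
    have : z.re ∈ Q.roots := (mem_roots hQ.ne_zero).mpr hz
    simp [h3] at this

/-- A monic polynomial is determined by its multiset of complex zeros, here a submultiset of K
copies of Z. -/
theorem finite_monic_of_zeros_subset {Z : Set ℂ} (hZ : Z.Finite) (K : ℕ) :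
    {Q : ℝ[X] | Q.Monic ∧ Q.natDegree ≤ K ∧ ∀ z : ℂ, aeval z Q = 0 → z ∈ Z}.Finite := by
  refine Set.Finite.of_finite_image (f := fun Q => (Q.map (algebraMap ℝ ℂ)).roots) ?_ ?_
  · refine (Set.finite_Iic (K • hZ.toFinset.val)).subset ?_
    rintro _ ⟨Q, ⟨hQ, hK, hroots⟩, rfl⟩
    rw [Set.mem_Iic, Multiset.le_iff_count]
    intro z
    by_cases hz : z ∈ (Q.map (algebraMap ℝ ℂ)).roots
    · have hzZ : z ∈ hZ.toFinset :=
        hZ.mem_toFinset.mpr (hroots z ((mem_roots_map hQ.ne_zero).mp hz))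
      rw [Multiset.count_nsmul, Multiset.count_eq_one_of_mem hZ.toFinset.nodup hzZ, mul_one]
      refine (Multiset.count_le_card _ _).trans ((card_roots' _).trans ?_)
      rwa [natDegree_map]
    · rw [Multiset.count_eq_zero_of_notMem hz]
      exact Nat.zero_le _
  · intro Q hQ R hR h
    refine map_injective _ (algebraMap ℝ ℂ).injective ?_
    rw [(IsAlgClosed.splits (Q.map (algebraMap ℝ ℂ))).eq_prod_roots_of_monic (hQ.1.map _),
      (IsAlgClosed.splits (R.map (algebraMap ℝ ℂ))).eq_prod_roots_of_monic (hR.1.map _)]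
    exact congrArg (fun s : Multiset ℂ => (s.map fun a => X - C a).prod) h

theorem finite_nonrealZeros {P : ℝ[X]} (hP : P ≠ 0) : (nonrealZeros P).Finite :=
  (P.rootSet_finite ℂ).subset fun _ hz => (mem_rootSet_of_ne hP).mpr hz.1

/-! ### Assembly -/

theorem hermiteRaise_hermiteComb {K n : ℕ} (γ : ℕ → ℝ) (h : K ≤ n) :
    hermiteRaise (hermiteComb K γ n) = hermiteComb K γ (n + 1) := by
  rw [hermiteComb_eq_aeval γ h, hermiteComb_eq_aeval γ (by omega : K ≤ n + 1),
    show n + 1 - K = (n - K) + 1 by omega, pow_succ', mul_assoc, map_mul _ X, aeval_X]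
  rfl

theorem hermiteComb_zeros {K n : ℕ} {γ : ℕ → ℝ} (h : K ≤ n)
    (hq : HasSimpleRealRoots n (hermiteComb K γ n)) :
    OnlyRealZeros (hermiteComb K γ n) ∧ OnlySimpleZeros (hermiteComb K γ n) ∧
      ZerosInterlace (hermiteComb K γ (n + 1)) (hermiteComb K γ n) :=
  ⟨hq.onlyRealZeros, hq.onlySimpleZeros, hermiteRaise_hermiteComb γ h ▸ hq.raise⟩

/-- Real zeros of the symbol may be removed when proving that `q_n` has real simple zeros. -/
theorem hasSimpleRealRoots_hermiteComb {K n : ℕ} {γ : ℕ → ℝ} (h : K ≤ n)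
    {s : Multiset ℝ} {Q : ℝ[X]} (hP : (s.map fun a => X - C a).prod * Q = symbolP K γ)
    (hK : s.card + Q.natDegree = K)
    (hQ : HasSimpleRealRoots (n - K + Q.natDegree) (aeval hermiteRaise (X ^ (n - K) * Q) 1)) :
    HasSimpleRealRoots n (hermiteComb K γ n) := by
  have := hQ.aeval_prod_X_sub_C s
  rwa [← Module.End.mul_apply, ← map_mul, mul_left_comm, hP, ← hermiteComb_eq_aeval γ h,
    show n - K + Q.natDegree + s.card = n by omega] at this

theorem mainTheorem1 (K : ℕ) :
    (∀ γ : ℕ → ℝ, γ 0 = 1 → γ K ≠ 0 → OnlyRealZeros (symbolP K γ) →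
      ∀ n : ℕ, K ≤ n →
        OnlyRealZeros (hermiteComb K γ n) ∧ OnlySimpleZeros (hermiteComb K γ n) ∧
        ZerosInterlace (hermiteComb K γ (n + 1)) (hermiteComb K γ n)) ∧
    (∀ Z : Set ℂ, Z.Nonempty →
      ∃ n₀ : ℕ, 0 < n₀ ∧ K ≤ n₀ ∧
        ∀ γ : ℕ → ℝ, γ 0 = 1 → γ K ≠ 0 → nonrealZeros (symbolP K γ) = Z →
          ∀ n : ℕ, n₀ ≤ n →
            OnlyRealZeros (hermiteComb K γ n) ∧ OnlySimpleZeros (hermiteComb K γ n) ∧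
            ZerosInterlace (hermiteComb K γ (n + 1)) (hermiteComb K γ n)) := by
  refine ⟨fun γ h0 _ hreal n hn => ?_, fun Z _ => ?_⟩
  · obtain ⟨hd, hm⟩ := symbolP_natDegree_monic (K := K) h0
    obtain ⟨Q, hQ, h1, h2, h3⟩ := hm.exists_nonreal_cofactor
    have hQ1 : Q = 1 := by
      by_contra hne
      obtain ⟨z, hz⟩ := IsAlgClosed.exists_aeval_eq_zero ℂ Q fun hd0 =>
        hne (hQ.natDegree_eq_zero.mp (natDegree_eq_of_degree_eq_some hd0))
      exact (h3 z hz).2 (hreal z (h3 z hz).1)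
    refine hermiteComb_zeros hn (hasSimpleRealRoots_hermiteComb hn h1 (h2.trans hd) ?_)
    simpa [hQ1, hermiteH_eq_pow_apply] using hasSimpleRealRoots_hermiteH (n - K)
  · by_cases hZ : Z.Finite
    · have hN : ∀ Q : ℝ[X], ∃ N : ℕ, Q.Monic → ∀ n, N ≤ n →
          HasSimpleRealRoots (n + Q.natDegree) (aeval hermiteRaise (X ^ n * Q) 1) := by
        intro Q
        by_cases hQ : Q.Monic
        · obtain ⟨N, hN⟩ := exists_forall_hasSimpleRealRoots_aeval hQ
          exact ⟨N, fun _ => hN⟩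
        · exact ⟨0, fun h => absurd h hQ⟩
      choose N hN using hN
      -- The summand K is needed because the threshold for Q bounds the exponent n - K; the 1
      -- ensures positivity.
      refine ⟨K + 1 + (finite_monic_of_zeros_subset hZ K).toFinset.sup N, by omega, by omega,
        fun γ h0 _ hγ n hn => ?_⟩
      obtain ⟨hd, hm⟩ := symbolP_natDegree_monic (K := K) h0
      obtain ⟨Q, hQ, h1, h2, h3⟩ := hm.exists_nonreal_cofactor
      have hle : N Q ≤ (finite_monic_of_zeros_subset hZ K).toFinset.sup N :=
        Finset.le_sup (f := N) ((Set.Finite.mem_toFinset _).mpr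
          ⟨hQ, by omega, fun z hz => hγ ▸ h3 z hz⟩)
      have hn' : K ≤ n := by omega
      exact hermiteComb_zeros hn' (hasSimpleRealRoots_hermiteComb hn' h1 (h2.trans hd)
        (hN Q hQ _ (by omega)))
    -- An infinite Z is not the set of non-real zeros of any symbol, so any threshold serves.
    · exact ⟨K + 1, by omega, by omega, fun γ h0 _ hγ => absurd
        (hγ ▸ finite_nonrealZeros (symbolP_natDegree_monic h0).2.ne_zero) hZ⟩
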